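/- **Setting.** Let $\mathcal L$ be a Hausdorff, first countable $n$-dimensional lamination (a space with a maximal atlas of charts in a fixed deck $\mathbb R^n\times S$ whose transitions carry connected cards $O\times\{t\}$ to cards) with a dense leaf $L\ni x$. Let $p:\widetilde L\to L$ be the universal cover of $L$ in its leaf topology, let $\tilde x$ lie over $x$, and let $G$ (the diophantine group) act on $\widetilde L$ by homeomorphisms. Let $T\ni x$ be a complete open transversal such that any two points of $\widetilde L$ over $T\cap L$ differ by an element of $G$. (Suspensions, quasisuspensions, double coset foliations and locally free Lie group actions give such data.) Fix an ultrafilter $\mathfrak U$ on $\mathbb N$ all of whose elements are infinite, and let ${}^*G$ be the ultrapower of $G$. *Fundamental germ.* ${}^*\mathsf D\subset{}^*G$ is the set of classes of sequences $(g_\alpha)$ such that $g_\alpha\tilde x$ lies over $T$ and projects to a sequence converging to $x$; put $\pi={}^*\mathsf D\cdot({}^*\mathsf D)^{-1}$ (the fundamental germ $[\![\pi]\!]_1(\mathcal L,x)$). *Germ universal cover.* A sequence in $\widetilde L$ is convergent if its projection converges in $\mathcal L$. Two convergent sequences are asymptotic if their projections have the same limit $\hat x$ and if, for every flow box about $\hat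 x$, their terms lie in a common lift of a plaque of this flow box for $\mathfrak U$-almost all indices. $[\mathcal L]$ is the set of asymptotic classes, and $\lim:[\mathcal L]\to\mathcal L$ takes the limit. Two classes lie on a common plaque over a flow box if their limits lie on a common plaque of it and they have representatives lying, for $\mathfrak U$-almost all indices, in common lifts of plaques of it. These plaques generate the leaf topology of $[\mathcal L]$, whose connected components are the leaves. An element $u\in\pi$ acts on a class $a$ if for some representatives the sequence $(u_\alpha\tilde x_\alpha)$ is convergent with limit $\lim a$; its class is then $u\cdot a$. The germ $\pi$ is *a group* if it is closed under multiplication, each $u\in\pi$ is a well-defined map on all of $[\mathcal L]$, and products act by composition. It is *tame* if $\lim a=\lim b$ implies $b=u\cdot a$ for some $u\in\pi$. *Topologies.* Suppose $\pi$ is tame and a group. Let $\tau$ be a germ universal cover topology on $[\mathcal L]$ on which $\pi$ acts by homeomorphisms. That is, locally $\tau$ consists of sheets which $\lim$ maps homeomorphically onto flow boxes and which carry the plaques of $[\mathcal L]$; and over some complete open transversal $T_0$ there is a continuous section $i:T_0\to[\mathcal L]$ of $\lim$, meeting each leaf at most once, such that $\lim^{-1}(T_0)$ is the disjoint union of the translates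 $u\cdot i(T_0)$, $u\in\pi$, and $u\cdot i(t)=u'\cdot i(t)$ only if $u=u'$. Let $\mathsf C$ be a normal subgroup of $\pi$, $\mathcal L_{\mathsf C}=\mathsf C\backslash[\mathcal L]$, and let $P_{\mathsf C}:\mathcal L_{\mathsf C}\to\mathcal L$ be the map induced by $\lim$. Let $\sigma$ be a *covering topology*: a topology on $[\mathcal L]$ maximal, with respect to inclusion, among those for which 1. $\mathcal L_{\mathsf C}$, with the quotient topology, has a (possibly non-Hausdorff) lamination structure whose leaf topology is the quotient of that of $[\mathcal L]$, in which every leaf over $L$ is dense, and for which $P_{\mathsf C}$ is a lamination map; 2. for no complete open transversal of $\mathcal L_{\mathsf C}$ does its preimage in $[\mathcal L]$ contain an orbit of $\mathsf C$ as an open subset; 3. every open set is $\tau$-open, and $\pi$ acts by homeomorphisms. Suppose that $\mathcal L_{\mathsf C}$ with the topology induced by $\sigma$ is Hausdorff, and give it a lamination structure with the leaf topology of (1). Let $\mathsf{Aut}(P_{\mathsf C})$ be the group of the homeomorphisms $F$ of $\mathcal L_{\mathsf C}$ with $P_{\mathsf C}\circ F=P_{\mathsf C}$ that carry leaves homeomorphically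 onto leaves and transversals onto transversals, and that are geometric: $F$ is covered by a homeomorphism $\Phi$ of $([\mathcal L],\sigma)$ with $\Phi(c\cdot a)=f(c)\cdot\Phi(a)$ for some automorphism $f$ of $\mathsf C$ and all $c\in\mathsf C$, $a\in[\mathcal L]$. **Theorem.** The action $\mathsf C a\mapsto\mathsf C(u\cdot a)$ of $\pi$ on $\mathcal L_{\mathsf C}$ induces an isomorphism $\pi/\mathsf C\cong\mathsf{Aut}(P_{\mathsf C})$. Moreover $P_{\mathsf C}$ induces a homeomorphism from the quotient of $\mathcal L_{\mathsf C}$ by this group onto $\mathcal L$. -/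

import Mathlib

open Set Filter Topology

namespace GermLam

universe u v w

/-- The horizontal factor `ℝⁿ` of a deck of cards `ℝⁿ × S`. -/
abbrev Horiz (n : ℕ) : Type := EuclideanSpace ℝ (Fin n)

/-! ### Laminations -/

section Lamination

variable {n : ℕ}

/-- The transition from the chart `φ` to the chart `ψ` carries every connected card `O × {t}` of its
domain onto a card.  (Cards with a disconnected base may be carried to several cards; the continuous
dependence of the transition on `t` is part of its being a homeomorphism.) -/
def CardCompatible {X : Type u} [TopologicalSpace X] {S : Type v} [TopologicalSpace S]
    (φ ψ : OpenPartialHomeomorph X (Horiz n × S)) : Prop :=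
  ∀ (O : Set (Horiz n)) (t : S), IsOpen O → IsPreconnected O →
    O ×ˢ {t} ⊆ (φ.symm.trans ψ).source →
    ∃ (O' : Set (Horiz n)) (t' : S), IsOpen O' ∧ (φ.symm.trans ψ) '' (O ×ˢ {t}) = O' ×ˢ {t'}

/-- An `n`-dimensional lamination structure on a topological space: a maximal atlas of charts with
values in a fixed deck of cards `ℝⁿ × S`, whose transitions carry cards to cards.  No separation
property is built in. -/
structure Lamination (n : ℕ) (X : Type u) (top : TopologicalSpace X) where
  /-- the transverse model -/
  S : Type u
  topS : TopologicalSpace S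
  atlas : Set (OpenPartialHomeomorph X (Horiz n × S))
  cover : ∀ x : X, ∃ φ ∈ atlas, x ∈ φ.source
  compatible : ∀ φ ∈ atlas, ∀ ψ ∈ atlas, CardCompatible φ ψ
  maximal : ∀ φ : OpenPartialHomeomorph X (Horiz n × S),
    (∀ ψ ∈ atlas, CardCompatible φ ψ ∧ CardCompatible ψ φ) → φ ∈ atlas

attribute [instance] Lamination.topS

variable {X : Type u} {top : TopologicalSpace X}

/-- A flow box `φ⁻¹(O × T')`, with `O` an open ball of `ℝⁿ` and `T'` open in the transverse
model. -/
structure Lamination.FlowBox (𝓛 : Lamination n X top) where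
  φ : OpenPartialHomeomorph X (Horiz n × 𝓛.S)
  mem_atlas : φ ∈ 𝓛.atlas
  center : Horiz n
  radius : ℝ
  radius_pos : 0 < radius
  T' : Set 𝓛.S
  isOpen_T' : IsOpen T'
  subset_target : Metric.ball center radius ×ˢ T' ⊆ φ.target

/-- The points of a flow box. -/
def Lamination.FlowBox.carrier {𝓛 : Lamination n X top} (B : 𝓛.FlowBox) : Set X :=
  B.φ.symm '' (Metric.ball B.center B.radius ×ˢ B.T')

/-- The plaque of a flow box at height `t`. -/
def Lamination.FlowBox.plaque {𝓛 : Lamination n X top} (B : 𝓛.FlowBox) (t : 𝓛.S) : Set X :=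
  B.φ.symm '' (Metric.ball B.center B.radius ×ˢ {t})

/-- The leaf topology, generated by the plaques: the space becomes the disjoint union of its
leaves, each with its topology of an `n`-manifold. -/
@[reducible] def Lamination.leafTopology (𝓛 : Lamination n X top) : TopologicalSpace X :=
  TopologicalSpace.generateFrom {P | ∃ B : 𝓛.FlowBox, ∃ t ∈ B.T', P = B.plaque t}

/-- The leaf through a point: a maximal continuation of overlapping plaques. -/
def Lamination.leaf (𝓛 : Lamination n X top) (x : X) : Set X :=
  @connectedComponent X 𝓛.leafTopology x

/-- Open transversals `φ⁻¹({a} × T')`. -/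
def Lamination.IsTransversal (𝓛 : Lamination n X top) (T : Set X) : Prop :=
  ∃ φ ∈ 𝓛.atlas, ∃ (a : Horiz n) (T' : Set 𝓛.S), IsOpen T' ∧ {a} ×ˢ T' ⊆ φ.target ∧
    T = φ.symm '' ({a} ×ˢ T')

/-- A transversal is complete if it meets every leaf. -/
def Lamination.IsComplete (𝓛 : Lamination n X top) (T : Set X) : Prop :=
  ∀ x : X, (𝓛.leaf x ∩ T).Nonempty

/-- Lamination maps: continuous maps that carry leaves into leaves and, locally, transversals into
transversals. -/
structure IsLaminationMap {Y : Type v} {topY : TopologicalSpace Y}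
    (𝓛 : Lamination n X top) (𝓜 : Lamination n Y topY) (F : X → Y) : Prop where
  continuous : Continuous F
  leaf_to_leaf : ∀ x : X, F '' 𝓛.leaf x ⊆ 𝓜.leaf (F x)
  transversal : ∀ x : X, ∃ T T', 𝓛.IsTransversal T ∧ x ∈ T ∧ 𝓜.IsTransversal T' ∧ F x ∈ T' ∧
    F '' T ⊆ T'

end Lamination

/-! ### The fundamental germ -/

/-- A weakly minimal lamination on `X` together with the data that enter its fundamental germ: an
ultrafilter on `ℕ` all of whose elements are infinite, a dense leaf `L` with universal cover
`p : Lt → L` (for the leaf topology), a group `G` (the diophantine group) acting on `Lt` by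
homeomorphisms, a point `xt` of `Lt` over the base point `p xt` of `L`, and a diophantine
transversal `T` through the base point.  Suspensions, quasisuspensions, double coset foliations
and locally free Lie group actions provide such data. -/
structure GermData (n : ℕ) (X : Type u) [top : TopologicalSpace X] (Lt : Type v) [TopologicalSpace Lt]
    (G : Type w) [Group G] [MulAction G Lt] where
  U : Ultrafilter ℕ
  infinite_of_mem : ∀ A ∈ U, A.Infinite
  lam : Lamination n X top
  p : Lt → X
  xt : Lt
  simplyConnected : SimplyConnectedSpace Lt
  covering : @IsCoveringMapOn Lt X _ lam.leafTopology p (lam.leaf (p xt))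
  range_eq : range p = lam.leaf (p xt)
  dense_leaf : Dense (lam.leaf (p xt))
  continuous_smul : ∀ g : G, Continuous fun y : Lt => g • y
  T : Set X
  isTransversal : lam.IsTransversal T
  isComplete : lam.IsComplete T
  mem_T : p xt ∈ T
  diophantine : ∀ y z : Lt, p y ∈ T → p z ∈ T → ∃ g : G, z = g • y

namespace GermData

variable {n : ℕ} {X : Type u} [top : TopologicalSpace X] {Lt : Type v} [TopologicalSpace Lt]
  {G : Type w} [Group G] [MulAction G Lt]

/-- The ultrapower `*G`. -/
abbrev StarG (D : GermData n X Lt G) : Type w := (D.U : Filter ℕ).Germ G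

/-- The classes in `*G` of the diophantine approximations of the base point along `T` based at
`xt`: sequences `g` with `g α • xt` over `T` and converging to the base point. -/
def dioph (D : GermData n X Lt G) : Set D.StarG :=
  {a | ∃ g : ℕ → G, (g : D.StarG) = a ∧ (∀ α, D.p (g α • D.xt) ∈ D.T) ∧
    Tendsto (fun α => D.p (g α • D.xt)) atTop (𝓝 (D.p D.xt))}

/-- The fundamental germ `*D · *D⁻¹`. -/
def germ (D : GermData n X Lt G) : Set D.StarG :=
  {a | ∃ g ∈ D.dioph, ∃ h ∈ D.dioph, a = g * h⁻¹}

/-! ### The germ universal cover -/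

/-- Sequences in `Lt` whose projection converges in the lamination. -/
def ConvSeq (D : GermData n X Lt G) : Type v :=
  {s : ℕ → Lt // ∃ x : X, Tendsto (fun α => D.p (s α)) atTop (𝓝 x)}

/-- `y` and `z` lie in a common lift of a plaque of the flow box `B` (the lifts of a plaque are the
path components of its preimage in `Lt`). -/
def CommonLift (D : GermData n X Lt G) (B : D.lam.FlowBox) (y z : Lt) : Prop :=
  ∃ t ∈ B.T', JoinedIn (D.p ⁻¹' B.plaque t) y z

/-- Asymptotic convergent sequences: the projections converge to the same point `x`, and for every
flow box about `x` the two sequences lie, for `U`-almost all indices, in a common lift of a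
plaque. -/
def Asymptotic (D : GermData n X Lt G) (s s' : D.ConvSeq) : Prop :=
  ∃ x : X, Tendsto (fun α => D.p (s.1 α)) atTop (𝓝 x) ∧
    Tendsto (fun α => D.p (s'.1 α)) atTop (𝓝 x) ∧
    ∀ B : D.lam.FlowBox, x ∈ B.carrier → ∀ᶠ α in (D.U : Filter ℕ), D.CommonLift B (s.1 α) (s'.1 α)

lemma flowBox_isOpen {𝓛 : Lamination n X top} (B : 𝓛.FlowBox) : IsOpen B.carrier :=
  B.φ.isOpen_image_symm_of_subset_target (Metric.isOpen_ball.prod B.isOpen_T') B.subset_target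

lemma U_le (D : GermData n X Lt G) : (D.U : Filter ℕ) ≤ atTop := by
  rw [← Nat.cofinite_eq_atTop]
  intro A hA
  by_contra h
  exact D.infinite_of_mem Aᶜ (Ultrafilter.compl_mem_iff_notMem.2 h) (mem_cofinite.1 hA)

lemma CommonLift.trans {D : GermData n X Lt G} {B : D.lam.FlowBox} {a b c : Lt}
    (h : D.CommonLift B a b) (h' : D.CommonLift B b c) : D.CommonLift B a c := by
  obtain ⟨t, ht, j⟩ := h
  obtain ⟨t', ht', j'⟩ := h'
  obtain ⟨⟨q, r⟩, ⟨hq, hr⟩, e⟩ := j.target_mem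
  obtain ⟨⟨q', r'⟩, ⟨hq', hr'⟩, e'⟩ := j'.source_mem
  simp only [mem_singleton_iff] at hr hr'
  subst hr hr'
  have := B.φ.symm.injOn (B.subset_target ⟨hq, ht⟩) (B.subset_target ⟨hq', ht'⟩) (e.trans e'.symm)
  rw [Prod.mk.injEq] at this
  obtain ⟨-, rfl⟩ := this
  exact ⟨_, ht, j.trans j'⟩

variable [T2Space X]

/-- The relation of being asymptotic is an equivalence relation. -/
def asympSetoid (D : GermData n X Lt G) : Setoid D.ConvSeq where
  r := D.Asymptotic
  iseqv :=
    { refl := fun s => by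
        obtain ⟨x, hx⟩ := s.2
        refine ⟨x, hx, hx, fun B hB => ?_⟩
        have := D.U_le (hx ((flowBox_isOpen B).mem_nhds hB))
        filter_upwards [this] with α hα
        obtain ⟨⟨q, r⟩, ⟨hq, hr⟩, e⟩ := hα
        exact ⟨r, hr, JoinedIn.refl ⟨(q, r), ⟨hq, rfl⟩, e⟩⟩
      symm := by
        rintro s s' ⟨x, h, h', H⟩
        refine ⟨x, h', h, fun B hB => ?_⟩
        filter_upwards [H B hB] with α hα
        obtain ⟨t, ht, j⟩ := hα
        exact ⟨t, ht, j.symm⟩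
      trans := by
        rintro s s' s'' ⟨x, h, h', H⟩ ⟨y, k, k', K⟩
        obtain rfl := tendsto_nhds_unique h' k
        refine ⟨x, h, k', fun B hB => ?_⟩
        filter_upwards [H B hB, K B hB] with α hα hα'
        exact hα.trans hα' }

/-- The germ universal cover: asymptotic classes of convergent sequences. -/
def Cover (D : GermData n X Lt G) : Type v := Quotient D.asympSetoid

/-- The class of a convergent sequence. -/
def cls (D : GermData n X Lt G) (s : D.ConvSeq) : D.Cover := Quotient.mk D.asympSetoid s

/-- The projection of the germ universal cover onto the lamination: the limit of a class. -/
noncomputable def lim (D : GermData n X Lt G) : D.Cover → X :=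
  Quotient.lift (fun s : D.ConvSeq => s.2.choose) (by
    rintro s s' ⟨x, h, h', -⟩
    exact (tendsto_nhds_unique s.2.choose_spec h).trans
      (tendsto_nhds_unique s'.2.choose_spec h').symm)

/-- The plaque of the germ universal cover through `a` over the flow box `B`: the classes `b` whose
limit lies in the same plaque of `B` as that of `a`, and that are represented by a sequence which
lies with one representing `a` in common lifts of plaques of `B`, for `U`-almost all indices. -/
def plaque (D : GermData n X Lt G) (B : D.lam.FlowBox) (a : D.Cover) : Set D.Cover :=
  {b | (∃ t ∈ B.T', D.lim a ∈ B.plaque t ∧ D.lim b ∈ B.plaque t) ∧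
    ∃ s s' : D.ConvSeq, D.cls s = a ∧ D.cls s' = b ∧
      ∀ᶠ α in (D.U : Filter ℕ), D.CommonLift B (s.1 α) (s'.1 α)}

/-- The leaf topology of the germ universal cover, generated by its plaques. -/
@[reducible] def leafTop (D : GermData n X Lt G) : TopologicalSpace D.Cover :=
  TopologicalSpace.generateFrom {P | ∃ (B : D.lam.FlowBox) (a : D.Cover),
    D.lim a ∈ B.carrier ∧ P = D.plaque B a}

/-- The leaves of the germ universal cover. -/
def leaf (D : GermData n X Lt G) (a : D.Cover) : Set D.Cover :=
  @connectedComponent D.Cover D.leafTop a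

/-! ### The geometric groupoid structure -/

/-- `D.Acts g a b`: the element `g` of `*G` is defined on the class `a` and carries it to `b`; that
is, for some representatives the sequence `g α • s α` is convergent, with the limit of `a`, and it
represents `b`. -/
def Acts (D : GermData n X Lt G) (g : D.StarG) (a b : D.Cover) : Prop :=
  ∃ (γ : ℕ → G) (s s' : D.ConvSeq), (γ : D.StarG) = g ∧ D.cls s = a ∧ D.cls s' = b ∧
    (∀ α, s'.1 α = γ α • s.1 α) ∧ D.lim b = D.lim a

/-- The fundamental germ, with its geometric groupoid structure, is a group: it is closed under
multiplication, each of its elements is a map defined on the whole germ universal cover, and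
products act by composition. -/
structure IsGroup (D : GermData n X Lt G) : Prop where
  mul_mem : ∀ g ∈ D.germ, ∀ h ∈ D.germ, g * h ∈ D.germ
  total : ∀ g ∈ D.germ, ∀ a : D.Cover, ∃! b : D.Cover, D.Acts g a b
  comp : ∀ g ∈ D.germ, ∀ h ∈ D.germ, ∀ a b c : D.Cover,
    D.Acts h a b → D.Acts g b c → D.Acts (g * h) a c

/-- Tameness: any two classes with the same limit are related by an element of the germ. -/
def IsTame (D : GermData n X Lt G) : Prop :=
  ∀ a b : D.Cover, D.lim a = D.lim b → ∃ g ∈ D.germ, D.Acts g a b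

lemma one_mem_germ (D : GermData n X Lt G) : (1 : D.StarG) ∈ D.germ := by
  have h : (1 : D.StarG) ∈ D.dioph :=
    ⟨fun _ => 1, rfl, fun _ => by simpa using D.mem_T, by simp⟩
  exact ⟨1, h, 1, h, by simp⟩

/-- The fundamental germ as a subgroup of `*G`. -/
def group (D : GermData n X Lt G) (hD : D.IsGroup) : Subgroup D.StarG where
  carrier := D.germ
  mul_mem' := fun {g h} hg hh => hD.mul_mem g hg h hh
  one_mem' := D.one_mem_germ
  inv_mem' := by
    rintro _ ⟨g, hg, h, hh, rfl⟩
    exact ⟨h, hh, g, hg, by simp⟩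

lemma acts_one (D : GermData n X Lt G) (a : D.Cover) : D.Acts 1 a a := by
  obtain ⟨s, rfl⟩ := Quotient.exists_rep a
  exact ⟨fun _ => 1, s, s, rfl, rfl, rfl, fun α => by simp, rfl⟩

/-- The action of the fundamental germ on the germ universal cover, when it is a group. -/
noncomputable instance instMulAction (D : GermData n X Lt G) (hD : D.IsGroup) :
    MulAction (D.group hD) D.Cover where
  smul g a := (hD.total g.1 g.2 a).choose
  one_smul a :=
    (hD.total 1 D.one_mem_germ a).unique
      (hD.total (1 : D.group hD).1 (1 : D.group hD).2 a).choose_spec.1 (D.acts_one a)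
  mul_smul g h a :=
    (hD.total (g * h).1 (g * h).2 a).unique
      (hD.total (g * h).1 (g * h).2 a).choose_spec.1
      (hD.comp g.1 g.2 h.1 h.2 a _ _ (hD.total h.1 h.2 a).choose_spec.1
        (hD.total g.1 g.2 _).choose_spec.1)

lemma acts_smul (D : GermData n X Lt G) (hD : D.IsGroup) (g : D.group hD) (a : D.Cover) :
    D.Acts g.1 a (g • a) :=
  (hD.total g.1 g.2 a).choose_spec.1

lemma lim_smul (D : GermData n X Lt G) (hD : D.IsGroup) (g : D.group hD) (a : D.Cover) :
    D.lim (g • a) = D.lim a := by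
  obtain ⟨_, _, _, _, _, _, _, h⟩ := D.acts_smul hD g a
  exact h

/-! ### Topologies on the germ universal cover -/

/-- `τ` is a germ universal cover topology for which the fundamental germ acts by homeomorphisms.
It is obtained from a decomposition of the preimage of a transversal `T` into the disjoint
translates `g • i(T)` of a section `i` over `T` that meets each leaf at most once; the sections are
topologized through their identification with `T`, and `τ` is the associated product lamination
structure: locally it consists of copies of flow boxes, with the plaques of the germ universal
cover. -/
structure IsEquivariantTopology (D : GermData n X Lt G) (hD : D.IsGroup)
    (τ : TopologicalSpace D.Cover) : Prop where
  sheet : ∀ a : D.Cover, ∃ (B : D.lam.FlowBox) (s : X → D.Cover),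
    (∀ x ∈ B.carrier, D.lim (s x) = x) ∧
    a ∈ s '' B.carrier ∧
    (∀ x ∈ B.carrier, ∀ t ∈ B.T', x ∈ B.plaque t → s '' B.plaque t = D.plaque B (s x)) ∧
    (∀ V ⊆ B.carrier, IsOpen[τ] (s '' V) ↔ IsOpen V) ∧
    ∀ V : Set D.Cover, IsOpen[τ] V → IsOpen (s ⁻¹' V ∩ B.carrier)
  decomposition : ∃ (T : Set X) (i : T → D.Cover), D.lam.IsTransversal T ∧ D.lam.IsComplete T ∧
    (∀ t : T, D.lim (i t) = t) ∧
    (∀ t t' : T, i t' ∈ D.leaf (i t) → t' = t) ∧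
    Continuous[inferInstance, τ] i ∧
    (∀ (g g' : D.group hD) (t t' : T), g • i t = g' • i t' → g = g' ∧ t = t') ∧
    ∀ a : D.Cover, D.lim a ∈ T → ∃ (g : D.group hD) (t : T), g • i t = a
  smul_continuous : ∀ g : D.group hD, Continuous[τ, τ] fun a : D.Cover => g • a

/-! ### The quotient by a subgroup -/

section Quotient

variable (D : GermData n X Lt G) (hD : D.IsGroup) (C : Subgroup (D.group hD))

/-- The quotient of the germ universal cover by the subgroup `C`. -/
noncomputable def Quot : Type v := MulAction.orbitRel.Quotient C D.Cover

/-- The quotient map. -/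
noncomputable def toQuot (a : D.Cover) : D.Quot hD C := Quotient.mk (MulAction.orbitRel C D.Cover) a

/-- The projection of the quotient onto the lamination. -/
noncomputable def proj : D.Quot hD C → X :=
  Quotient.lift D.lim (by
    rintro a b ⟨c, rfl⟩
    exact D.lim_smul hD c.1 b)

/-- The quotient topology induced by a topology on the germ universal cover. -/
@[reducible] noncomputable def quotTop (σ : TopologicalSpace D.Cover) : TopologicalSpace (D.Quot hD C) :=
  σ.coinduced (D.toQuot hD C)

/-- The leaf topology of the quotient, induced by that of the germ universal cover. -/
@[reducible] noncomputable def quotLeafTop : TopologicalSpace (D.Quot hD C) :=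
  D.leafTop.coinduced (D.toQuot hD C)

/-- Lamination structures on the quotient, with the topology induced by `σ`, whose leaves are the
images of the leaves of the germ universal cover. -/
structure QuotLamination (σ : TopologicalSpace D.Cover) where
  lam : Lamination n (D.Quot hD C) (D.quotTop hD C σ)
  leafTopology_eq : lam.leafTopology = D.quotLeafTop hD C

/-- The topologies `σ` among which the covering topology is a maximal one:
* the quotient, with the induced topology, is a (possibly non Hausdorff) lamination in which the
  leaves over the dense leaf are dense, and which projects by a lamination map; no orbit of `C` is
  open in the preimage of a (complete open) transversal of the quotient that contains it;
* the identity map from `σ` to `τ` is open;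
* the fundamental germ acts by homeomorphisms for `σ`. -/
structure IsCandidate (τ σ : TopologicalSpace D.Cover) : Prop where
  lamination : ∃ 𝓜 : D.QuotLamination hD C σ,
    (∀ ξ : D.Quot hD C, D.proj hD C ξ ∈ D.lam.leaf (D.p D.xt) →
      @Dense _ (D.quotTop hD C σ) (𝓜.lam.leaf ξ)) ∧
    IsLaminationMap 𝓜.lam D.lam (D.proj hD C) ∧
    ∀ T : Set (D.Quot hD C), 𝓜.lam.IsTransversal T → 𝓜.lam.IsComplete T →
      ∀ a : D.Cover, D.toQuot hD C a ∈ T →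
        ¬ ∃ V : Set D.Cover, IsOpen[σ] V ∧
          V ∩ D.toQuot hD C ⁻¹' T = {b | ∃ c : C, b = c • a}
  id_open : ∀ V : Set D.Cover, IsOpen[σ] V → IsOpen[τ] V
  smul_continuous : ∀ g : D.group hD, Continuous[σ, σ] fun a : D.Cover => g • a

/-- Covering topologies: the maximal candidates, for the inclusion of families of open sets. -/
structure IsCoveringTopology (τ σ : TopologicalSpace D.Cover) : Prop where
  isCandidate : D.IsCandidate hD C τ σ
  maximal : ∀ σ' : TopologicalSpace D.Cover, D.IsCandidate hD C τ σ' →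
    (∀ V : Set D.Cover, IsOpen[σ] V → IsOpen[σ'] V) →
    ∀ V : Set D.Cover, IsOpen[σ'] V → IsOpen[σ] V

variable {D hD C}

/-- The automorphisms of the covering `proj`: lamination homeomorphisms of the quotient (they carry
leaves homeomorphically to leaves, and transversals to transversals) over the identity of the
lamination that are geometric, that is, covered by a homeomorphism `Φ` of the germ universal cover
which is equivariant with respect to an automorphism `f` of the group `C`, the fundamental germ of
the quotient. -/
structure IsAutomorphism {σ : TopologicalSpace D.Cover} (𝓜 : D.QuotLamination hD C σ)
    (F : Equiv.Perm (D.Quot hD C)) : Prop where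
  proj_eq : ∀ ξ, D.proj hD C (F ξ) = D.proj hD C ξ
  isHomeomorph : @IsHomeomorph _ _ (D.quotTop hD C σ) (D.quotTop hD C σ) F
  leaves : @IsHomeomorph _ _ 𝓜.lam.leafTopology 𝓜.lam.leafTopology F
  transversals : ∀ T : Set (D.Quot hD C), 𝓜.lam.IsTransversal (F '' T) ↔ 𝓜.lam.IsTransversal T
  geometric : ∃ (f : C ≃* C) (Φ : Equiv.Perm D.Cover), @IsHomeomorph _ _ σ σ Φ ∧
    (∀ a, D.toQuot hD C (Φ a) = F (D.toQuot hD C a)) ∧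
    ∀ (c : C) (a : D.Cover), Φ (c • a) = f c • Φ a

lemma isHomeomorph_symm {Y : Type v} {t : TopologicalSpace Y} {F : Equiv.Perm Y}
    (h : IsHomeomorph F) : IsHomeomorph (F⁻¹ : Equiv.Perm Y) := by
  have e : (F⁻¹ : Equiv.Perm Y) = ((h.homeomorph F).symm : Y → Y) := by
    funext y
    apply F.injective
    exact (F.apply_symm_apply y).trans ((h.homeomorph F).apply_symm_apply y).symm
  rw [e]
  exact (h.homeomorph F).symm.isHomeomorph

variable (D hD C) in
/-- The group of automorphisms of the covering `proj`. -/
def Aut {σ : TopologicalSpace D.Cover} (𝓜 : D.QuotLamination hD C σ) :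
    Subgroup (Equiv.Perm (D.Quot hD C)) where
  carrier := {F | IsAutomorphism 𝓜 F}
  one_mem' :=
    { proj_eq := fun _ => rfl
      isHomeomorph := @IsHomeomorph.id _ (D.quotTop hD C σ)
      leaves := @IsHomeomorph.id _ 𝓜.lam.leafTopology
      transversals := fun T => by simp
      geometric := ⟨MulEquiv.refl C, 1, @IsHomeomorph.id _ σ, fun _ => rfl, fun _ _ => rfl⟩ }
  mul_mem' := by
    rintro F F' h h'
    obtain ⟨f, Φ, hΦ, hF, hf⟩ := h.geometric
    obtain ⟨f', Φ', hΦ', hF', hf'⟩ := h'.geometric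
    refine ⟨fun ξ => (h.proj_eq _).trans (h'.proj_eq ξ), ?_, ?_, fun T => ?_, f'.trans f, Φ * Φ', ?_, ?_,
      ?_⟩
    · rw [Equiv.Perm.coe_mul]
      exact @IsHomeomorph.comp _ _ _ (D.quotTop hD C σ) (D.quotTop hD C σ) (D.quotTop hD C σ)
        _ _ h.isHomeomorph h'.isHomeomorph
    · rw [Equiv.Perm.coe_mul]
      exact @IsHomeomorph.comp _ _ _ 𝓜.lam.leafTopology 𝓜.lam.leafTopology 𝓜.lam.leafTopology
        _ _ h.leaves h'.leaves
    · rw [Equiv.Perm.coe_mul, image_comp, h.transversals, h'.transversals]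
    · rw [Equiv.Perm.coe_mul]
      exact @IsHomeomorph.comp _ _ _ σ σ σ _ _ hΦ hΦ'
    · intro a
      simp [hF, hF']
    · intro c a
      simp [hf, hf']
  inv_mem' := by
    rintro F h
    obtain ⟨f, Φ, hΦ, hF, hf⟩ := h.geometric
    refine ⟨fun ξ => ?_, ?_, ?_, fun T => ?_, f.symm, Φ⁻¹, ?_, fun a => ?_, fun c a => ?_⟩
    · have := h.proj_eq (F⁻¹ ξ)
      simpa using this.symm
    · exact @isHomeomorph_symm _ (D.quotTop hD C σ) _ h.isHomeomorph
    · exact @isHomeomorph_symm _ 𝓜.lam.leafTopology _ h.leaves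
    · rw [← h.transversals (_ '' T), ← image_comp, ← Equiv.Perm.coe_mul]
      simp
    · exact @isHomeomorph_symm _ σ _ hΦ
    · apply F.injective
      rw [← hF]
      simp
    · apply Φ.injective
      rw [hf]
      simp

end Quotient

end GermData

end GermLam

namespace GermLam

universe u v w

/-! The proof follows the classical argument for Galois coverings, with density of leaves replacing
connectedness of the total space. An element of the germ descends to the quotient because `C` is
normal, and conjugation gives the automorphism of `C` required by geometricity. Three facts then
carry the isomorphism.

Leafwise continuity: the germ is only assumed to act continuously for `τ` and `σ`. On the sheets of
`τ` an element sends the section through `b` to the section through `g • b`, hence plaques to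
plaques (`continuous_smul_leafTop`). A homeomorphism for both topologies preserves the maximal
atlas, because card compatibility can be characterised through the leaf topology (`IsLeafwise`); so
transversals go to transversals.

Rigidity (`eq_one_of_apply_eq`): the fixed set of an automorphism is closed, as the quotient is
Hausdorff, and leafwise open, as the projection is leafwise locally injective. If it contains a
point over the dense leaf, it contains that point's leaf, which is dense, and so everything.

Tameness: an automorphism moves a class within a fibre of the limit, where some germ element does
the same; by rigidity the two agree. The kernel is `C` because the translates of the section `i` are
disjoint.

For the last claim, the same transitivity makes the induced map injective, first countability makes
it surjective, and it is open because `lim` is open for `τ`, which refines `σ`. -/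

theorem exists_path_lift_of_isCoveringMapOn {E X : Type*} [TopologicalSpace E] [TopologicalSpace X]
    {f : E → X} {s : Set X} (h : IsCoveringMapOn f s) {γ : unitInterval → X} (hγ : Continuous γ)
    (hs : ∀ r, γ r ∈ s) {e : E} (he : f e = γ 0) :
    ∃ Γ : unitInterval → E, Continuous Γ ∧ (∀ r, f (Γ r) = γ r) ∧ Γ 0 = e := by
  have cov := h.isCoveringMap_restrictPreimage
  obtain ⟨Γ, hΓ, h0⟩ := cov.exists_path_lifts
    ⟨fun r => (⟨γ r, hs r⟩ : s), hγ.subtype_mk hs⟩ ⟨e, show f e ∈ s from he ▸ hs 0⟩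
    (Subtype.ext he.symm)
  exact ⟨fun r => (Γ r).1, continuous_subtype_val.comp Γ.continuous,
    fun r => congrArg Subtype.val (congrFun hΓ r), congrArg Subtype.val h0⟩

theorem _root_.IsPreconnected.eq_of_eventually_eq {α β : Type*} [TopologicalSpace α] {s : Set α}
    (hs : IsPreconnected s) {f : α → β} (hf : ∀ y ∈ s, ∀ᶠ z in 𝓝[s] y, f z = f y) {x y : α}
    (hx : x ∈ s) (hy : y ∈ s) : f x = f y := by
  -- For the discrete topology on the target, local constancy is continuity.
  let _ : TopologicalSpace β := ⊥
  have : DiscreteTopology β := ⟨rfl⟩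
  exact hs.constant (fun y hy => tendsto_nhds_of_eventually_eq (hf y hy)) hx hy

/-! ### Flow boxes, the leaf topology and leafwise charts -/

section Lamination

variable {n : ℕ} {X : Type u} {top : TopologicalSpace X} {𝓛 : Lamination n X top}

namespace Lamination

namespace FlowBox

theorem mem_plaque_iff {B : 𝓛.FlowBox} {t : 𝓛.S} (ht : t ∈ B.T') {x : X} :
    x ∈ B.plaque t ↔ x ∈ B.φ.source ∧ (B.φ x).1 ∈ Metric.ball B.center B.radius ∧
      (B.φ x).2 = t := by
  constructor
  · rintro ⟨⟨q, r⟩, ⟨hq, hr⟩, rfl⟩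
    obtain rfl : r = t := hr
    have := B.subset_target ⟨hq, ht⟩
    rw [B.φ.right_inv this]
    exact ⟨B.φ.map_target this, hq, rfl⟩
  · rintro ⟨hx, hq, rfl⟩
    exact ⟨B.φ x, ⟨hq, rfl⟩, B.φ.left_inv hx⟩

theorem mem_carrier_iff {B : 𝓛.FlowBox} {x : X} :
    x ∈ B.carrier ↔ x ∈ B.φ.source ∧ (B.φ x).1 ∈ Metric.ball B.center B.radius ∧
      (B.φ x).2 ∈ B.T' := by
  constructor
  · rintro ⟨⟨q, r⟩, ⟨hq, hr⟩, rfl⟩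
    have := B.subset_target ⟨hq, hr⟩
    rw [B.φ.right_inv this]
    exact ⟨B.φ.map_target this, hq, hr⟩
  · rintro ⟨hx, hq, hr⟩
    exact ⟨B.φ x, ⟨hq, hr⟩, B.φ.left_inv hx⟩

theorem mem_plaque_of_mem_carrier {B : 𝓛.FlowBox} {x : X} (hx : x ∈ B.carrier) :
    (B.φ x).2 ∈ B.T' ∧ x ∈ B.plaque (B.φ x).2 := by
  rw [mem_carrier_iff] at hx
  exact ⟨hx.2.2, (mem_plaque_iff hx.2.2).2 ⟨hx.1, hx.2.1, rfl⟩⟩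

theorem plaque_subset_carrier (B : 𝓛.FlowBox) {t : 𝓛.S} (ht : t ∈ B.T') :
    B.plaque t ⊆ B.carrier :=
  image_mono (prod_mono_right (singleton_subset_iff.2 ht))

theorem isOpen_plaque (B : 𝓛.FlowBox) {t : 𝓛.S} (ht : t ∈ B.T') :
    IsOpen[𝓛.leafTopology] (B.plaque t) :=
  TopologicalSpace.isOpen_generateFrom_of_mem ⟨B, t, ht, rfl⟩

end FlowBox

/-- Flow boxes of a given chart form a neighbourhood basis at each point of its source. -/
theorem exists_flowBox (𝓛 : Lamination n X top) {φ : OpenPartialHomeomorph X (Horiz n × 𝓛.S)}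
    (hφ : φ ∈ 𝓛.atlas) {x : X} (hx : x ∈ φ.source) {V : Set X} (hV : IsOpen V) (hxV : x ∈ V) :
    ∃ B : 𝓛.FlowBox, B.φ = φ ∧ x ∈ B.carrier ∧ B.carrier ⊆ V := by
  have hW : φ.target ∩ φ.symm ⁻¹' V ∈ 𝓝 (φ x) :=
    (φ.isOpen_inter_preimage_symm hV).mem_nhds
      ⟨φ.map_source hx, by rwa [mem_preimage, φ.left_inv hx]⟩
  rw [show φ x = ((φ x).1, (φ x).2) from rfl, nhds_prod_eq] at hW
  obtain ⟨⟨r, T'⟩, ⟨hr, hT, hTo⟩, hsub⟩ :=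
    (Metric.nhds_basis_ball.prod (nhds_basis_opens (φ x).2)).mem_iff.1 hW
  refine ⟨⟨φ, hφ, (φ x).1, r, hr, T', hTo, fun z hz => (hsub hz).1⟩, rfl, ?_, ?_⟩
  · exact ⟨φ x, ⟨Metric.mem_ball_self hr, hT⟩, φ.left_inv hx⟩
  · rintro _ ⟨z, hz, rfl⟩
    exact (hsub hz).2

/-- The transition carries the whole connected card into one card, which has a single height. -/
theorem snd_eq_of_card (𝓛 : Lamination n X top) {φ ψ : OpenPartialHomeomorph X (Horiz n × 𝓛.S)}
    (hφ : φ ∈ 𝓛.atlas) (hψ : ψ ∈ 𝓛.atlas) {O : Set (Horiz n)} (hO : IsOpen O)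
    (hO' : IsPreconnected O) {t : 𝓛.S} (ht : ∀ q ∈ O, (q, t) ∈ φ.target)
    (hs : ∀ q ∈ O, φ.symm (q, t) ∈ ψ.source) {q q' : Horiz n} (hq : q ∈ O) (hq' : q' ∈ O) :
    (ψ (φ.symm (q, t))).2 = (ψ (φ.symm (q', t))).2 := by
  obtain ⟨O₁, t₁, -, h⟩ := 𝓛.compatible φ hφ ψ hψ O t hO hO' (by
    rintro ⟨y, s⟩ ⟨hy, hs'⟩
    obtain rfl : s = t := hs'
    simpa using ⟨ht y hy, hs y hy⟩)
  have key : ∀ y ∈ O, (ψ (φ.symm (y, t))).2 = t₁ := fun y hy =>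
    (h.subset (mem_image_of_mem _ (⟨hy, rfl⟩ : (y, t) ∈ O ×ˢ {t}))).2
  rw [key q hq, key q' hq']

/-- Plaques of a flow box contained in another one lie in plaques of the latter. -/
theorem FlowBox.plaque_subset_plaque {B B' : 𝓛.FlowBox} (h : B.carrier ⊆ B'.carrier) {t : 𝓛.S}
    (ht : t ∈ B.T') : ∃ t' ∈ B'.T', B.plaque t ⊆ B'.plaque t' := by
  have hc : (B.center, t) ∈ Metric.ball B.center B.radius ×ˢ B.T' :=
    ⟨Metric.mem_ball_self B.radius_pos, ht⟩
  have hmem : ∀ q ∈ Metric.ball B.center B.radius, B.φ.symm (q, t) ∈ B'.carrier :=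
    fun q hq => h ⟨(q, t), ⟨hq, ht⟩, rfl⟩
  have h0 := FlowBox.mem_carrier_iff.1 (hmem B.center hc.1)
  refine ⟨_, h0.2.2, ?_⟩
  rintro _ ⟨⟨q, s⟩, ⟨hq, hs⟩, rfl⟩
  obtain rfl : s = t := hs
  have h1 := FlowBox.mem_carrier_iff.1 (hmem q hq)
  refine (FlowBox.mem_plaque_iff h0.2.2).2 ⟨h1.1, h1.2.1, ?_⟩
  exact snd_eq_of_card 𝓛 B.mem_atlas B'.mem_atlas Metric.isOpen_ball
    (convex_ball _ _).isPreconnected (fun y hy => B.subset_target ⟨hy, ht⟩)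
    (fun y hy => (FlowBox.mem_carrier_iff.1 (hmem y hy)).1) hq hc.1

/-- The leaf topology is finer than the given one. -/
theorem leafTopology_le (𝓛 : Lamination n X top) : 𝓛.leafTopology ≤ top := by
  intro V hV
  refine (@isOpen_iff_forall_mem_open _ 𝓛.leafTopology _).2 fun x hx => ?_
  obtain ⟨φ, hφ, hxφ⟩ := 𝓛.cover x
  obtain ⟨B, -, hB, hBV⟩ := 𝓛.exists_flowBox hφ hxφ hV hx
  obtain ⟨ht, hxB⟩ := FlowBox.mem_plaque_of_mem_carrier hB
  exact ⟨_, (B.plaque_subset_carrier ht).trans hBV, B.isOpen_plaque ht, hxB⟩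

/-- Charts that are leafwise charts for the leaf topology: their horizontal slices are continuous
into the leaf topology, in which their transverse coordinate is locally constant. -/
structure IsLeafwise (𝓛 : Lamination n X top) (φ : OpenPartialHomeomorph X (Horiz n × 𝓛.S)) :
    Prop where
  continuousOn_slice : ∀ t : 𝓛.S, @ContinuousOn _ _ _ 𝓛.leafTopology (fun q => φ.symm (q, t))
    {q | (q, t) ∈ φ.target}
  locally_constant : ∀ x ∈ φ.source, ∃ N : Set X, IsOpen[𝓛.leafTopology] N ∧ x ∈ N ∧
    N ⊆ φ.source ∧ ∀ y ∈ N, (φ y).2 = (φ x).2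

/-- Continuity of a slice is tested on plaques: ordinary continuity sends a small ball into the flow
box, and since the ball is connected its image stays at one height, that of the plaque. For local
constancy, a plaque of a flow box of the chart itself serves as `N`. -/
theorem isLeafwise_of_mem_atlas (𝓛 : Lamination n X top)
    {φ : OpenPartialHomeomorph X (Horiz n × 𝓛.S)} (hφ : φ ∈ 𝓛.atlas) : 𝓛.IsLeafwise φ where
  continuousOn_slice t := by
    intro q hq
    refine TopologicalSpace.tendsto_nhds_generateFrom_iff.2 ?_
    rintro _ ⟨B, s, hs, rfl⟩ hmem
    have hW : φ.target ∩ φ.symm ⁻¹' B.carrier ∈ 𝓝 (q, t) :=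
      (φ.isOpen_inter_preimage_symm (GermData.flowBox_isOpen B)).mem_nhds
        ⟨hq, B.plaque_subset_carrier hs hmem⟩
    have hW' : ∀ᶠ y in 𝓝 q, (y, t) ∈ φ.target ∩ φ.symm ⁻¹' B.carrier :=
      (Continuous.prodMk_left t).continuousAt.preimage_mem_nhds hW
    obtain ⟨r, hr, hsub⟩ := Metric.nhds_basis_ball.mem_iff.1 hW'
    refine mem_nhdsWithin_of_mem_nhds (mem_of_superset (Metric.ball_mem_nhds q hr) fun y hy => ?_)
    have hy' := FlowBox.mem_carrier_iff.1 (hsub hy).2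
    refine (FlowBox.mem_plaque_iff hs).2 ⟨hy'.1, hy'.2.1, ?_⟩
    rw [← ((FlowBox.mem_plaque_iff hs).1 hmem).2.2]
    exact snd_eq_of_card 𝓛 hφ B.mem_atlas Metric.isOpen_ball (convex_ball _ _).isPreconnected
      (fun z hz => (hsub hz).1) (fun z hz => (FlowBox.mem_carrier_iff.1 (hsub hz).2).1) hy
      (Metric.mem_ball_self hr)
  locally_constant x hx := by
    obtain ⟨B, rfl, hB, -⟩ := 𝓛.exists_flowBox hφ hx isOpen_univ (mem_univ x)
    obtain ⟨ht, hxB⟩ := FlowBox.mem_plaque_of_mem_carrier hB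
    exact ⟨_, B.isOpen_plaque ht, hxB, fun y hy => ((FlowBox.mem_plaque_iff ht).1 hy).1,
      fun y hy => ((FlowBox.mem_plaque_iff ht).1 hy).2.2⟩

/-- Near each of its points the card contains the part of `N`, where the height is constant, cut out
by an open condition on the horizontal coordinate. -/
theorem IsLeafwise.isOpen_card {φ : OpenPartialHomeomorph X (Horiz n × 𝓛.S)}
    (hφ : 𝓛.IsLeafwise φ) {O : Set (Horiz n)} (hO : IsOpen O) {t : 𝓛.S}
    (ht : O ×ˢ {t} ⊆ φ.target) : IsOpen[𝓛.leafTopology] (φ.symm '' (O ×ˢ {t})) := by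
  refine (@isOpen_iff_forall_mem_open _ 𝓛.leafTopology _).2 ?_
  rintro _ ⟨⟨q, s⟩, hq, rfl⟩
  obtain rfl : s = t := hq.2
  obtain ⟨N, hN, hmem, hsub, hc⟩ := hφ.locally_constant _ (φ.map_target (ht hq))
  have hV : IsOpen (φ.source ∩ φ ⁻¹' (Prod.fst ⁻¹' O)) :=
    φ.isOpen_inter_preimage (hO.preimage continuous_fst)
  refine ⟨N ∩ (φ.source ∩ φ ⁻¹' (Prod.fst ⁻¹' O)), ?_,
    @IsOpen.inter _ 𝓛.leafTopology _ _ hN (𝓛.leafTopology_le _ hV), hmem, φ.map_target (ht hq), ?_⟩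
  · rintro y ⟨hyN, hy, hyO⟩
    refine ⟨φ y, ⟨hyO, ?_⟩, φ.left_inv hy⟩
    rw [mem_singleton_iff, hc y hyN, φ.right_inv (ht hq)]
  · rw [mem_preimage, mem_preimage, φ.right_inv (ht hq)]
    exact hq.1

/-- This converse to `isLeafwise_of_mem_atlas` turns maximality of the atlas into a criterion
involving only the two topologies. Along a connected card the height in `ψ` is locally constant,
hence constant. -/
theorem IsLeafwise.cardCompatible {φ ψ : OpenPartialHomeomorph X (Horiz n × 𝓛.S)}
    (hφ : 𝓛.IsLeafwise φ) (hψ : 𝓛.IsLeafwise ψ) : CardCompatible φ ψ := by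
  intro O t hO hOc hsub
  have ht : O ×ˢ {t} ⊆ φ.target := fun z hz => by simpa using (hsub hz).1
  have hs : ∀ z ∈ O ×ˢ {t}, φ.symm z ∈ ψ.source := fun z hz => by simpa using (hsub hz).2
  rcases O.eq_empty_or_nonempty with rfl | ⟨q₀, hq₀⟩
  · exact ⟨∅, t, isOpen_empty, by simp⟩
  have hconst : ∀ q ∈ O, (ψ (φ.symm (q, t))).2 = (ψ (φ.symm (q₀, t))).2 := by
    intro q hq
    refine hOc.eq_of_eventually_eq (f := fun q => (ψ (φ.symm (q, t))).2) ?_ hq hq₀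
    intro y hy
    obtain ⟨N, hN, hmem, -, hc⟩ := hψ.locally_constant _ (hs (y, t) ⟨hy, rfl⟩)
    have hev : ∀ᶠ z in 𝓝[O] y, φ.symm (z, t) ∈ N :=
      nhdsWithin_mono y (fun z hz => ht (show (z, t) ∈ O ×ˢ {t} from ⟨hz, rfl⟩)) <| (hφ.continuousOn_slice t) y (ht ⟨hy, rfl⟩)
        (@IsOpen.mem_nhds _ 𝓛.leafTopology _ _ hN hmem)
    exact hev.mono fun z hz => hc _ hz
  set t' := (ψ (φ.symm (q₀, t))).2
  have himg := hφ.isOpen_card hO ht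
  -- The base of the image card is the preimage of a leaf-open card under the slice of `ψ` at height
  -- `t'`, hence open.
  refine ⟨{q | (q, t') ∈ ψ.target ∧ ψ.symm (q, t') ∈ φ.symm '' (O ×ˢ {t})}, t', ?_, ?_⟩
  · have ho : IsOpen {q | (q, t') ∈ ψ.target} := ψ.open_target.preimage (Continuous.prodMk_left t')
    exact @ContinuousOn.isOpen_inter_preimage _ _ _ 𝓛.leafTopology _ _ _
      (hψ.continuousOn_slice t') ho himg
  · ext ⟨q, s⟩
    constructor
    · rintro ⟨⟨y, r⟩, hy, he⟩
      obtain rfl : r = t := hy.2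
      have hyψ := hs _ hy
      replace he : ψ (φ.symm (y, r)) = (q, s) := he
      have hst : s = t' := by rw [← hconst y hy.1, he]
      subst hst
      refine ⟨⟨he ▸ ψ.map_source hyψ, (y, r), hy, ?_⟩, rfl⟩
      rw [← he, ψ.left_inv hyψ]
    · rintro ⟨⟨h1, z, hz, he⟩, hst⟩
      obtain rfl : s = t' := hst
      refine ⟨z, hz, ?_⟩
      show ψ (φ.symm z) = _
      rw [he, ψ.right_inv h1]

/-- Homeomorphisms for both the topology and the leaf topology preserve the atlas. -/
theorem symm_trans_mem_atlas (𝓛 : Lamination n X top) (H : X ≃ₜ X)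
    (hH : Continuous[𝓛.leafTopology, 𝓛.leafTopology] H)
    (hH' : Continuous[𝓛.leafTopology, 𝓛.leafTopology] H.symm)
    {φ : OpenPartialHomeomorph X (Horiz n × 𝓛.S)} (hφ : φ ∈ 𝓛.atlas) :
    H.symm.toOpenPartialHomeomorph.trans φ ∈ 𝓛.atlas := by
  have h := 𝓛.isLeafwise_of_mem_atlas hφ
  have key : 𝓛.IsLeafwise (H.symm.toOpenPartialHomeomorph.trans φ) := by
    refine ⟨fun t => ?_, fun x hx => ?_⟩
    · have := @Continuous.comp_continuousOn _ _ _ _ 𝓛.leafTopology 𝓛.leafTopology _ _ _ hH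
        (h.continuousOn_slice t)
      refine @ContinuousOn.mono _ _ _ 𝓛.leafTopology _ _ _ this ?_
      intro q hq
      simpa using hq
    · have hx' : H.symm x ∈ φ.source := by simpa using hx
      obtain ⟨N, hN, hmem, hsub, hc⟩ := h.locally_constant _ hx'
      exact ⟨H.symm ⁻¹' N, @Continuous.isOpen_preimage _ _ 𝓛.leafTopology 𝓛.leafTopology _ hH' _ hN, hmem,
        fun y hy => by simpa using hsub hy,
        fun y hy => hc _ hy⟩
  exact 𝓛.maximal _ fun ψ hψ =>
    ⟨key.cardCompatible (𝓛.isLeafwise_of_mem_atlas hψ),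
      (𝓛.isLeafwise_of_mem_atlas hψ).cardCompatible key⟩

theorem IsTransversal.image {T : Set X} (hT : 𝓛.IsTransversal T) (H : X ≃ₜ X)
    (hH : Continuous[𝓛.leafTopology, 𝓛.leafTopology] H)
    (hH' : Continuous[𝓛.leafTopology, 𝓛.leafTopology] H.symm) : 𝓛.IsTransversal (H '' T) := by
  obtain ⟨φ, hφ, a, T', hT', hsub, rfl⟩ := hT
  refine ⟨_, 𝓛.symm_trans_mem_atlas H hH hH' hφ, a, T', hT', fun z hz => ?_, ?_⟩
  · simpa using hsub hz
  · rw [← image_comp]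
    rfl

theorem isTransversal_image_iff {T : Set X} (H : X ≃ₜ X)
    (hH : Continuous[𝓛.leafTopology, 𝓛.leafTopology] H)
    (hH' : Continuous[𝓛.leafTopology, 𝓛.leafTopology] H.symm) :
    𝓛.IsTransversal (H '' T) ↔ 𝓛.IsTransversal T := by
  refine ⟨fun h => ?_, fun h => h.image H hH hH'⟩
  have := h.image H.symm hH' hH
  rwa [← image_comp, H.symm_comp_self, image_id] at this

/-- The segment between two points of a plaque, in the coordinates of the flow box. -/
theorem FlowBox.exists_path (B : 𝓛.FlowBox) {t : 𝓛.S} (ht : t ∈ B.T') {x y : X}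
    (hx : x ∈ B.plaque t) (hy : y ∈ B.plaque t) :
    ∃ γ : unitInterval → X, Continuous[inferInstance, 𝓛.leafTopology] γ ∧ γ 0 = x ∧ γ 1 = y ∧
      ∀ r, γ r ∈ B.plaque t := by
  obtain ⟨⟨q, s⟩, ⟨hq, hs⟩, rfl⟩ := hx
  obtain ⟨⟨q', s'⟩, ⟨hq', hs'⟩, rfl⟩ := hy
  obtain rfl : s = t := hs
  obtain rfl : s' = s := hs'
  have hJ : JoinedIn (Metric.ball B.center B.radius) q q' :=
    ((convex_ball _ _).isPathConnected ⟨q, hq⟩).joinedIn q hq q' hq'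
  obtain ⟨δ, hδ⟩ := hJ
  refine ⟨fun r => B.φ.symm (δ r, s'), ?_, by simp, by simp,
    fun r => ⟨(δ r, s'), ⟨hδ r, rfl⟩, rfl⟩⟩
  exact @ContinuousOn.comp_continuous _ _ _ _ _ 𝓛.leafTopology
    (fun q => B.φ.symm (q, s')) _ _
    ((𝓛.isLeafwise_of_mem_atlas B.mem_atlas).continuousOn_slice s') δ.continuous
    fun r => B.subset_target ⟨hδ r, ht⟩

theorem FlowBox.plaque_subset_leaf (B : 𝓛.FlowBox) {t : 𝓛.S} (ht : t ∈ B.T') {x y : X}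
    (hx : x ∈ B.plaque t) (hy : y ∈ B.plaque t) : y ∈ 𝓛.leaf x := by
  obtain ⟨γ, hγ, rfl, rfl, -⟩ := B.exists_path ht hx hy
  exact @IsPreconnected.subset_connectedComponent _ 𝓛.leafTopology _ _
    (@isPreconnected_range _ _ _ 𝓛.leafTopology _ _ hγ) (mem_range_self 0) _ (mem_range_self 1)

end Lamination

end Lamination

/-! ### Plaques and limits in the germ universal cover -/

namespace GermData

variable {n : ℕ} {X : Type u} [top : TopologicalSpace X] {Lt : Type v} [TopologicalSpace Lt]
  {G : Type w} [Group G] [MulAction G Lt]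

theorem CommonLift.mono {D : GermData n X Lt G} {B B' : D.lam.FlowBox}
    (hB : B.carrier ⊆ B'.carrier) {y z : Lt} (h : D.CommonLift B y z) : D.CommonLift B' y z := by
  obtain ⟨t, ht, j⟩ := h
  obtain ⟨t', ht', hsub⟩ := Lamination.FlowBox.plaque_subset_plaque hB ht
  exact ⟨t', ht', j.mono (preimage_mono hsub)⟩

/-- A path inside the plaque stays in the leaf that `p` covers, so it lifts from `z`, and the lift
remains over the plaque. -/
theorem exists_joinedIn (D : GermData n X Lt G) (B : D.lam.FlowBox) {t : D.lam.S} (ht : t ∈ B.T')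
    {z : Lt} (hz : D.p z ∈ B.plaque t) {y : X} (hy : y ∈ B.plaque t) :
    ∃ z' : Lt, D.p z' = y ∧ JoinedIn (D.p ⁻¹' B.plaque t) z z' := by
  obtain ⟨γ, hγ, h0, h1, hγB⟩ := B.exists_path ht hz hy
  have hz' : D.p z ∈ D.lam.leaf (D.p D.xt) := D.range_eq ▸ mem_range_self z
  have hleaf : ∀ r, γ r ∈ D.lam.leaf (D.p D.xt) := fun r => by
    have h := B.plaque_subset_leaf ht hz (hγB r)
    rwa [Lamination.leaf, ← @connectedComponent_eq _ D.lam.leafTopology _ _ hz'] at h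
  obtain ⟨Γ, hΓ, hlift, hΓ0⟩ := @exists_path_lift_of_isCoveringMapOn _ _ _ D.lam.leafTopology _ _
    D.covering γ hγ hleaf z h0.symm
  refine ⟨Γ 1, (hlift 1).trans h1, ⟨⟨Γ, hΓ⟩, hΓ0, rfl⟩, fun r => ?_⟩
  show D.p (Γ r) ∈ B.plaque t
  rw [hlift]
  exact hγB r

variable [T2Space X]

theorem tendsto_lim (D : GermData n X Lt G) (s : D.ConvSeq) :
    Tendsto (fun α => D.p (s.1 α)) atTop (𝓝 (D.lim (D.cls s))) :=
  s.2.choose_spec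

theorem lim_cls_eq {D : GermData n X Lt G} {s : D.ConvSeq} {x : X}
    (h : Tendsto (fun α => D.p (s.1 α)) atTop (𝓝 x)) : D.lim (D.cls s) = x :=
  tendsto_nhds_unique (D.tendsto_lim s) h

theorem eventually_commonLift {D : GermData n X Lt G} {s s' : D.ConvSeq} (h : D.cls s = D.cls s')
    {B : D.lam.FlowBox} (hB : D.lim (D.cls s) ∈ B.carrier) :
    ∀ᶠ α in (D.U : Filter ℕ), D.CommonLift B (s.1 α) (s'.1 α) := by
  obtain ⟨x, hx, -, H⟩ : D.Asymptotic s s' := Quotient.exact h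
  exact H B (lim_cls_eq hx ▸ hB)

theorem mem_plaque_self {D : GermData n X Lt G} {B : D.lam.FlowBox} {a : D.Cover}
    (h : D.lim a ∈ B.carrier) : a ∈ D.plaque B a := by
  obtain ⟨s, rfl⟩ := Quotient.exists_rep a
  obtain ⟨ht, hm⟩ := Lamination.FlowBox.mem_plaque_of_mem_carrier h
  exact ⟨⟨_, ht, hm, hm⟩, s, s, rfl, rfl, eventually_commonLift rfl h⟩

/-- The two representatives of the middle class are asymptotic, so they too lie in common lifts and
the three relations concatenate. -/
theorem plaque_trans {D : GermData n X Lt G} {B : D.lam.FlowBox} {a b c : D.Cover}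
    (hb : b ∈ D.plaque B a) (hc : c ∈ D.plaque B b) : c ∈ D.plaque B a := by
  obtain ⟨⟨t, ht, ha1, hb1⟩, s, s', rfl, rfl, h⟩ := hb
  obtain ⟨⟨t', ht', hb2, hc2⟩, r, r', hr, rfl, h'⟩ := hc
  obtain rfl : t = t' := ((Lamination.FlowBox.mem_plaque_iff ht).1 hb1).2.2.symm.trans
    ((Lamination.FlowBox.mem_plaque_iff ht').1 hb2).2.2
  refine ⟨⟨t, ht, ha1, hc2⟩, s, r', rfl, rfl, ?_⟩
  filter_upwards [h, h', eventually_commonLift hr.symm (B.plaque_subset_carrier ht hb1)]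
    with α h1 h2 h3
  exact (h1.trans h3).trans h2

theorem plaque_mono {D : GermData n X Lt G} {B B' : D.lam.FlowBox} (hB : B.carrier ⊆ B'.carrier)
    (a : D.Cover) : D.plaque B a ⊆ D.plaque B' a := by
  rintro b ⟨⟨t, ht, ha, hb⟩, s, s', hs, hs', h⟩
  obtain ⟨t', ht', hsub⟩ := Lamination.FlowBox.plaque_subset_plaque hB ht
  exact ⟨⟨t', ht', hsub ha, hsub hb⟩, s, s', hs, hs', h.mono fun _ => CommonLift.mono hB⟩

/-- The limit maps the plaques of the germ universal cover onto those of the lamination. -/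
theorem exists_mem_plaque (D : GermData n X Lt G) (B : D.lam.FlowBox) {t : D.lam.S}
    (ht : t ∈ B.T') {a : D.Cover} (ha : D.lim a ∈ B.plaque t) {y : X} (hy : y ∈ B.plaque t) :
    ∃ b ∈ D.plaque B a, D.lim b = y := by
  classical
  obtain ⟨s, rfl⟩ := Quotient.exists_rep a
  change D.lim (D.cls s) ∈ _ at ha
  have hlim := D.tendsto_lim s
  obtain ⟨hyφ, hyq, hyt⟩ := (Lamination.FlowBox.mem_plaque_iff ht).1 hy
  obtain ⟨hxφ, -, hxt⟩ := (Lamination.FlowBox.mem_plaque_iff ht).1 ha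
  -- Each term is slid along its own plaque to the horizontal coordinate of `y`. The heights
  -- converge to `t`, so the slid sequence converges to `y`. Terms outside `B` do not matter.
  have key : ∀ α, ∃ z : Lt, D.p (s.1 α) ∈ B.carrier →
      D.p z = B.φ.symm ((B.φ y).1, (B.φ (D.p (s.1 α))).2) ∧ D.CommonLift B (s.1 α) z := by
    intro α
    by_cases h : D.p (s.1 α) ∈ B.carrier
    · obtain ⟨h1, h2⟩ := Lamination.FlowBox.mem_plaque_of_mem_carrier h
      obtain ⟨z, hz, hj⟩ := D.exists_joinedIn B h1 h2
        (y := B.φ.symm ((B.φ y).1, (B.φ (D.p (s.1 α))).2)) ⟨((B.φ y).1, (B.φ (D.p (s.1 α))).2), ⟨hyq, rfl⟩, rfl⟩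
      exact ⟨z, fun _ => ⟨hz, _, h1, hj⟩⟩
    · exact ⟨s.1 α, fun h' => absurd h' h⟩
  choose z hz using key
  have hev : ∀ᶠ α in atTop, D.p (s.1 α) ∈ B.carrier :=
    hlim ((flowBox_isOpen B).mem_nhds (B.plaque_subset_carrier ht ha))
  have hconv : Tendsto (fun α => D.p (z α)) atTop (𝓝 y) := by
    have h1 : Tendsto (fun α => (B.φ (D.p (s.1 α))).2) atTop (𝓝 t) := by
      rw [← hxt]
      exact (continuous_snd.tendsto _).comp ((B.φ.continuousAt hxφ).tendsto.comp hlim)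
    have h2 : Tendsto (fun α => B.φ.symm ((B.φ y).1, (B.φ (D.p (s.1 α))).2)) atTop (𝓝 y) := by
      have hcont : ContinuousAt B.φ.symm (B.φ y) :=
        B.φ.symm.continuousAt (B.φ.map_source hyφ)
      rw [ContinuousAt, B.φ.left_inv hyφ] at hcont
      refine hcont.comp ?_
      have h3 := (tendsto_const_nhds (x := (B.φ y).1)).prodMk_nhds h1
      rwa [← hyt] at h3
    exact h2.congr' (hev.mono fun α hα => (hz α hα).1.symm)
  have hl : D.lim (D.cls ⟨z, y, hconv⟩) = y := lim_cls_eq hconv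
  refine ⟨D.cls ⟨z, y, hconv⟩, ⟨⟨t, ht, ha, hl.symm ▸ hy⟩, s, _, rfl, rfl, ?_⟩, hl⟩
  exact (hev.filter_mono D.U_le).mono fun α hα => (hz α hα).2

/-- First countability makes each point the limit of a sequence in the dense leaf, and such a
sequence lifts termwise. -/
theorem lim_surjective [FirstCountableTopology X] (D : GermData n X Lt G) :
    Function.Surjective D.lim := by
  intro x
  obtain ⟨y, hy, hyx⟩ := mem_closure_iff_seq_limit.1 (D.dense_leaf x)
  rw [← D.range_eq] at hy
  choose z hz using hy
  have h : Tendsto (fun α => D.p (z α)) atTop (𝓝 x) := by simpa only [hz] using hyx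
  exact ⟨D.cls ⟨z, x, h⟩, lim_cls_eq h⟩

/-! ### Leafwise continuity of the germ action -/

variable {D : GermData n X Lt G} {hD : D.IsGroup} {τ : TopologicalSpace D.Cover}

theorem smul_eq_of_acts {g : D.group hD} {a b : D.Cover} (h : D.Acts g.1 a b) : g • a = b :=
  (hD.total g.1 g.2 a).unique (D.acts_smul hD g a) h

/-- The limit is open for a germ universal cover topology. -/
theorem IsEquivariantTopology.isOpen_image_lim (hτ : D.IsEquivariantTopology hD τ)
    {V : Set D.Cover} (hV : IsOpen[τ] V) : IsOpen (D.lim '' V) := by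
  refine isOpen_iff_forall_mem_open.2 ?_
  rintro _ ⟨a, ha, rfl⟩
  obtain ⟨B, s, hs, ⟨x, hx, rfl⟩, -, -, hV'⟩ := hτ.sheet a
  refine ⟨s ⁻¹' V ∩ B.carrier, fun y hy => ⟨s y, hy.1, hs y hy.2⟩, hV' V hV, ?_⟩
  rw [hs x hx]
  exact ⟨ha, hx⟩

/-- The fundamental germ acts by homeomorphisms for the leaf topology. -/
theorem IsEquivariantTopology.continuous_smul_leafTop (hτ : D.IsEquivariantTopology hD τ)
    (g : D.group hD) : Continuous[D.leafTop, D.leafTop] fun a : D.Cover => g • a := by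
  refine continuous_generateFrom_iff.2 ?_
  rintro _ ⟨B, a, -, rfl⟩
  refine (@isOpen_iff_forall_mem_open _ D.leafTop _).2 fun b hb => ?_
  obtain ⟨B₁, s₁, hs₁, ⟨x₁, hx₁, e₁⟩, hpl₁, -, hV₁⟩ := hτ.sheet b
  obtain ⟨B₂, s₂, hs₂, ⟨x₂, hx₂, e₂⟩, hpl₂, hO₂, -⟩ := hτ.sheet (g • b)
  have hb₁ : x₁ = D.lim b := by rw [← e₁, hs₁ x₁ hx₁]
  have hb₂ : x₂ = D.lim b := by rw [← D.lim_smul hD g b, ← e₂, hs₂ x₂ hx₂]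
  subst hb₁ hb₂
  have hbB : D.lim b ∈ B.carrier := by
    obtain ⟨⟨t, ht, -, h⟩, -⟩ := hb
    rw [D.lim_smul] at h
    exact B.plaque_subset_carrier ht h
  have hWo : IsOpen[τ] ((fun a : D.Cover => g • a) ⁻¹' (s₂ '' B₂.carrier)) :=
    @Continuous.isOpen_preimage _ _ τ τ _ (hτ.smul_continuous g) _
      ((hO₂ _ Subset.rfl).2 (flowBox_isOpen B₂))
  have hV := hV₁ _ hWo
  set V := s₁ ⁻¹' ((fun a : D.Cover => g • a) ⁻¹' (s₂ '' B₂.carrier)) ∩ B₁.carrier with hVdef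
  -- Both sides lie on the sheet `s₂` and have limit `y`, which determines a point of that sheet.
  have hVs : ∀ y ∈ V, g • s₁ y = s₂ y := by
    rintro y ⟨⟨y', hy', he⟩, hy⟩
    have h1 := congrArg D.lim he
    rw [hs₂ y' hy'] at h1
    replace h1 : y' = y := by rw [h1, ← hs₁ y hy]; simp only [D.lim_smul, hs₁ y hy]
    subst h1
    exact he.symm
  obtain ⟨φ, hφ, hxφ⟩ := D.lam.cover (D.lim b)
  obtain ⟨B₃, -, hB₃, hsub⟩ := D.lam.exists_flowBox hφ hxφ
    ((hV.inter (flowBox_isOpen B₂)).inter (flowBox_isOpen B))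
    ⟨⟨⟨by rw [mem_preimage, e₁]; exact ⟨_, hx₂, e₂⟩, hx₁⟩, hx₂⟩, hbB⟩
  refine ⟨D.plaque B₃ b, fun c hc => ?_,
    TopologicalSpace.isOpen_generateFrom_of_mem ⟨B₃, b, hB₃, rfl⟩, mem_plaque_self hB₃⟩
  -- A plaque over the smaller box `B₃` that starts on a sheet stays on it.
  have sheet_eq : ∀ (B' : D.lam.FlowBox) (s : X → D.Cover), (∀ x ∈ B'.carrier, D.lim (s x) = x) →
      (∀ x ∈ B'.carrier, ∀ t ∈ B'.T', x ∈ B'.plaque t → s '' B'.plaque t = D.plaque B' (s x)) →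
      B₃.carrier ⊆ B'.carrier → ∀ a' c', D.lim a' ∈ B'.carrier → s (D.lim a') = a' →
      c' ∈ D.plaque B₃ a' → s (D.lim c') = c' := by
    intro B' s hs hpl hBB a' c' ha' hsa hc'
    obtain ⟨ht, hm⟩ := Lamination.FlowBox.mem_plaque_of_mem_carrier ha'
    have h := plaque_mono hBB a' hc'
    nth_rw 1 [← hsa] at h
    rw [← hpl _ ha' _ ht hm] at h
    obtain ⟨y, hy, rfl⟩ := h
    rw [hs y (B'.plaque_subset_carrier ht hy)]
  have hc₁ : s₁ (D.lim c) = c :=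
    sheet_eq B₁ s₁ hs₁ hpl₁ (fun y hy => (hsub hy).1.1.2) b c hx₁ e₁ hc
  obtain ⟨t, ht, hbt, hct⟩ := hc.1
  have hcV := hVs _ (hsub (B₃.plaque_subset_carrier ht hct)).1.1
  rw [hc₁] at hcV
  -- The plaque through `g • b` contains a class `d` with the limit of `c`. Since `d` and `g • c`
  -- both lie on the sheet `s₂`, they coincide.
  obtain ⟨d, hd, hdl⟩ := D.exists_mem_plaque B₃ ht (a := g • b) (by rwa [D.lim_smul]) hct
  have hd₂ : s₂ (D.lim d) = d :=
    sheet_eq B₂ s₂ hs₂ hpl₂ (fun y hy => (hsub hy).1.2) (g • b) d (by rwa [D.lim_smul])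
      (by rw [D.lim_smul, e₂]) hd
  rw [hdl, ← hcV] at hd₂
  show g • c ∈ D.plaque B a
  rw [hd₂]
  exact plaque_trans hb (plaque_mono (fun y hy => (hsub hy).2) _ hd)

/-! ### The quotient by `C` and rigidity of its automorphisms -/

variable {σ : TopologicalSpace D.Cover} {C : Subgroup (D.group hD)}

theorem toQuot_surjective : Function.Surjective (D.toQuot hD C) := Quotient.exists_rep

theorem toQuot_eq_iff {a b : D.Cover} :
    D.toQuot hD C a = D.toQuot hD C b ↔ ∃ c : C, c • b = a :=
  Quotient.eq (r := MulAction.orbitRel C D.Cover)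

theorem toQuot_smul (c : C) (a : D.Cover) : D.toQuot hD C (c • a) = D.toQuot hD C a :=
  toQuot_eq_iff.2 ⟨c, rfl⟩

/-- The action of the fundamental germ on the quotient by a normal subgroup. -/
noncomputable instance instMulActionQuot [C.Normal] : MulAction (D.group hD) (D.Quot hD C) where
  smul g := Quotient.lift (fun a => D.toQuot hD C (g • a)) (by
    rintro a b ⟨c, rfl⟩
    refine toQuot_eq_iff.2 ⟨MulAut.conjNormal g c, ?_⟩
    show (MulAut.conjNormal g c : D.group hD) • g • b = g • (c : D.group hD) • b
    rw [MulAut.conjNormal_apply, smul_smul, smul_smul, inv_mul_cancel_right])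
  one_smul ξ := by
    obtain ⟨a, rfl⟩ := toQuot_surjective ξ
    exact congrArg (D.toQuot hD C) (one_smul _ a)
  mul_smul g h ξ := by
    obtain ⟨a, rfl⟩ := toQuot_surjective ξ
    exact congrArg (D.toQuot hD C) (mul_smul g h a)

theorem smul_toQuot [C.Normal] (g : D.group hD) (a : D.Cover) :
    g • D.toQuot hD C a = D.toQuot hD C (g • a) :=
  rfl

theorem continuous_smul_coinduced [C.Normal] {t : TopologicalSpace D.Cover} {g : D.group hD}
    (h : Continuous[t, t] fun a : D.Cover => g • a) :
    Continuous[t.coinduced (D.toQuot hD C), t.coinduced (D.toQuot hD C)]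
      fun ξ : D.Quot hD C => g • ξ :=
  continuous_coinduced_dom.2
    (@Continuous.comp _ _ _ t t (t.coinduced (D.toQuot hD C)) _ _ continuous_coinduced_rng h)

/-- The elements of the fundamental germ induce automorphisms of the quotient. -/
theorem isAutomorphism_toPerm [C.Normal] (hτ : D.IsEquivariantTopology hD τ)
    (hσ : D.IsCandidate hD C τ σ) (𝓜 : D.QuotLamination hD C σ) (g : D.group hD) :
    IsAutomorphism 𝓜 (MulAction.toPerm g) := by
  have hc (g : D.group hD) := continuous_smul_coinduced (C := C) (hσ.smul_continuous g)
  have hl (g : D.group hD) := continuous_smul_coinduced (C := C) (hτ.continuous_smul_leafTop g)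
  change ∀ g : D.group hD, Continuous[D.quotLeafTop hD C, D.quotLeafTop hD C] _ at hl
  rw [← 𝓜.leafTopology_eq] at hl
  refine ⟨fun ξ => ?_, ?_, ?_, fun T => ?_, MulAut.conjNormal g, MulAction.toPerm g, ?_,
    fun a => rfl, fun c a => ?_⟩
  · obtain ⟨a, rfl⟩ := toQuot_surjective ξ
    exact D.lim_smul hD g a
  · exact (@Equiv.isHomeomorph_iff _ _ (D.quotTop hD C σ) (D.quotTop hD C σ) _).2 ⟨hc g, hc g⁻¹⟩
  · exact (@Equiv.isHomeomorph_iff _ _ 𝓜.lam.leafTopology 𝓜.lam.leafTopology _).2 ⟨hl g, hl g⁻¹⟩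
  · exact Lamination.isTransversal_image_iff (top := D.quotTop hD C σ)
      (@Homeomorph.mk _ _ (D.quotTop hD C σ) (D.quotTop hD C σ) (MulAction.toPerm g)
        (hc g) (hc g⁻¹)) (hl g) (hl g⁻¹)
  · exact (@Equiv.isHomeomorph_iff _ _ σ σ _).2 ⟨hσ.smul_continuous g, hσ.smul_continuous g⁻¹⟩
  · show g • (c : D.group hD) • a = (MulAut.conjNormal g c : D.group hD) • g • a
    rw [MulAut.conjNormal_apply, smul_smul, smul_smul, inv_mul_cancel_right]

/-- The projection of the quotient is locally injective for the leaf topology. -/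
theorem exists_injOn_proj (hτ : D.IsEquivariantTopology hD τ) (ξ : D.Quot hD C) :
    ∃ N : Set (D.Quot hD C), IsOpen[D.quotLeafTop hD C] N ∧ ξ ∈ N ∧ InjOn (D.proj hD C) N := by
  obtain ⟨a, rfl⟩ := toQuot_surjective ξ
  obtain ⟨B, s, hs, ⟨x, hx, rfl⟩, hpl, -, -⟩ := hτ.sheet a
  have hlim : D.lim (s x) ∈ B.carrier := by rwa [hs x hx]
  refine ⟨D.toQuot hD C '' D.plaque B (s x), ?_, mem_image_of_mem _ (mem_plaque_self hlim), ?_⟩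
  · rw [isOpen_coinduced]
    -- The saturation of a plaque is a union of its translates, open by leafwise continuity of the
    -- action.
    have : D.toQuot hD C ⁻¹' (D.toQuot hD C '' D.plaque B (s x)) =
        ⋃ c : C, (fun b : D.Cover => (c : D.group hD) • b) ⁻¹' D.plaque B (s x) := by
      ext b
      rw [mem_iUnion]
      constructor
      · rintro ⟨d, hd, he⟩
        obtain ⟨c, rfl⟩ := toQuot_eq_iff.1 he
        exact ⟨c, hd⟩
      · rintro ⟨c, hc⟩
        exact ⟨_, hc, toQuot_smul c b⟩
    rw [this]
    exact @isOpen_iUnion _ _ D.leafTop _ fun c =>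
      @Continuous.isOpen_preimage _ _ D.leafTop D.leafTop _ (hτ.continuous_smul_leafTop c.1) _
        (TopologicalSpace.isOpen_generateFrom_of_mem ⟨B, s x, hlim, rfl⟩)
  · obtain ⟨ht, hm⟩ := Lamination.FlowBox.mem_plaque_of_mem_carrier hx
    rw [← hpl x hx _ ht hm]
    rintro _ ⟨_, ⟨y, hy, rfl⟩, rfl⟩ _ ⟨_, ⟨z, hz, rfl⟩, rfl⟩ h
    change D.lim (s y) = D.lim (s z) at h
    rw [hs y (B.plaque_subset_carrier ht hy), hs z (B.plaque_subset_carrier ht hz)] at h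
    rw [h]

/-- An automorphism which fixes a point over the dense leaf is the identity. -/
theorem IsAutomorphism.eq_one_of_apply_eq {𝓜 : D.QuotLamination hD C σ}
    {F : Equiv.Perm (D.Quot hD C)} (hF : IsAutomorphism 𝓜 F) (hτ : D.IsEquivariantTopology hD τ)
    (hσ : D.IsCandidate hD C τ σ) (hT2 : @T2Space (D.Quot hD C) (D.quotTop hD C σ))
    {ξ : D.Quot hD C} (hξ : D.proj hD C ξ ∈ D.lam.leaf (D.p D.xt)) (h : F ξ = ξ) : F = 1 := by
  obtain ⟨𝓜', hdense, -, -⟩ := hσ.lamination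
  have hclosed : IsClosed[D.quotTop hD C σ] {η | F η = η} :=
    @isClosed_eq _ _ (D.quotTop hD C σ) (D.quotTop hD C σ) hT2 _ _
      (@IsHomeomorph.continuous _ _ (D.quotTop hD C σ) (D.quotTop hD C σ) _ hF.isHomeomorph)
      (@continuous_id _ (D.quotTop hD C σ))
  -- Near a fixed point both `ζ` and `F ζ` lie in `N`, where the projection is injective; they have
  -- the same projection, so they are equal.
  have hopen : IsOpen[𝓜.lam.leafTopology] {η | F η = η} := by
    refine (@isOpen_iff_forall_mem_open _ 𝓜.lam.leafTopology _).2 fun η hη => ?_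
    obtain ⟨N, hN, hηN, hinj⟩ := exists_injOn_proj hτ η
    rw [← 𝓜.leafTopology_eq] at hN
    refine ⟨F ⁻¹' N ∩ N, fun ζ hζ => hinj hζ.1 hζ.2 (hF.proj_eq ζ),
      @IsOpen.inter _ 𝓜.lam.leafTopology _ _
        (@Continuous.isOpen_preimage _ _ 𝓜.lam.leafTopology 𝓜.lam.leafTopology _
          (@IsHomeomorph.continuous _ _ 𝓜.lam.leafTopology 𝓜.lam.leafTopology _ hF.leaves) _ hN) hN, ?_, hηN⟩
    rw [mem_preimage, hη]
    exact hηN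
  have hleaf : 𝓜.lam.leaf ξ ⊆ {η | F η = η} :=
    @IsClopen.connectedComponent_subset _ 𝓜.lam.leafTopology _ _
      ⟨@IsClosed.mono _ _ _ _ hclosed 𝓜.lam.leafTopology_le, hopen⟩ h
  -- Density is known for the structure `𝓜'` supplied with `σ`, but leaves depend only on the leaf
  -- topology, which `𝓜` shares.
  have heq : 𝓜'.lam.leaf ξ = 𝓜.lam.leaf ξ := by
    rw [Lamination.leaf, Lamination.leaf, 𝓜.leafTopology_eq, 𝓜'.leafTopology_eq]
  have hd := hdense ξ hξ
  rw [heq] at hd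
  ext η
  have hfix : F η = η :=
    (@IsClosed.closure_subset_iff _ (D.quotTop hD C σ) _ _ hclosed).2 hleaf (hd η)
  rw [hfix]
  rfl

/-! ### The homomorphism to the automorphism group: kernel and image -/

theorem exists_lim_mem_leaf (D : GermData n X Lt G) :
    ∃ a : D.Cover, D.lim a ∈ D.lam.leaf (D.p D.xt) := by
  have h : D.lim (D.cls ⟨fun _ => D.xt, _, tendsto_const_nhds⟩) = D.p D.xt :=
    lim_cls_eq tendsto_const_nhds
  refine ⟨_, Eq.subst (motive := (· ∈ D.lam.leaf (D.p D.xt))) h.symm ?_⟩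
  exact @mem_connectedComponent _ D.lam.leafTopology _

theorem exists_smul_eq (hTame : D.IsTame) {a b : D.Cover} (h : D.lim a = D.lim b) :
    ∃ g : D.group hD, g • a = b := by
  obtain ⟨g, hg, hab⟩ := hTame a b h
  exact ⟨⟨g, hg⟩, smul_eq_of_acts hab⟩

/-- The homomorphism from the fundamental germ to the automorphisms of the quotient. -/
noncomputable def autHom [C.Normal] (hτ : D.IsEquivariantTopology hD τ)
    (hσ : D.IsCandidate hD C τ σ) (𝓜 : D.QuotLamination hD C σ) :
    D.group hD →* Aut D hD C 𝓜 :=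
  (MulAction.toPermHom (D.group hD) (D.Quot hD C)).codRestrict _
    (isAutomorphism_toPerm hτ hσ 𝓜)

theorem autHom_apply [C.Normal] (hτ : D.IsEquivariantTopology hD τ)
    (hσ : D.IsCandidate hD C τ σ) (𝓜 : D.QuotLamination hD C σ) (g : D.group hD)
    (ξ : D.Quot hD C) : (autHom hτ hσ 𝓜 g).1 ξ = g • ξ :=
  rfl

/-- If `g` acts trivially, then on a point of the section it agrees with some `c` in `C`; freeness
on the section gives `g = c`. Completeness of `T` only serves to supply such a point. -/
theorem autHom_eq_one_iff [C.Normal] (hτ : D.IsEquivariantTopology hD τ)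
    (hσ : D.IsCandidate hD C τ σ) (𝓜 : D.QuotLamination hD C σ) {g : D.group hD} :
    autHom hτ hσ 𝓜 g = 1 ↔ g ∈ C := by
  constructor
  · intro h
    obtain ⟨T, i, -, hT, -, -, -, hfree, -⟩ := hτ.decomposition
    obtain ⟨t, -, ht⟩ := hT (D.p D.xt)
    have h1 : g • D.toQuot hD C (i ⟨t, ht⟩) = D.toQuot hD C (i ⟨t, ht⟩) := by
      rw [← autHom_apply hτ hσ 𝓜, h]
      rfl
    obtain ⟨c, hc⟩ := toQuot_eq_iff.1 h1
    rw [← (hfree _ _ _ _ hc).1]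
    exact c.2
  · intro h
    refine Subtype.ext (Equiv.ext fun ξ => ?_)
    obtain ⟨a, rfl⟩ := toQuot_surjective ξ
    exact toQuot_smul ⟨g, h⟩ a

/-- By tameness some `g` agrees with `F` at one class over the dense leaf, so `g⁻¹ * F` fixes a
point there and rigidity applies. -/
theorem autHom_surjective [C.Normal] (hTame : D.IsTame) (hτ : D.IsEquivariantTopology hD τ)
    (hσ : D.IsCandidate hD C τ σ) (𝓜 : D.QuotLamination hD C σ)
    (hT2 : @T2Space (D.Quot hD C) (D.quotTop hD C σ)) :
    Function.Surjective (autHom hτ hσ 𝓜) := by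
  rintro F
  obtain ⟨a, ha⟩ := D.exists_lim_mem_leaf
  obtain ⟨b, hb⟩ := toQuot_surjective (F.1 (D.toQuot hD C a))
  obtain ⟨g, rfl⟩ : ∃ g : D.group hD, g • a = b := by
    refine exists_smul_eq hTame ?_
    have h := F.2.proj_eq (D.toQuot hD C a)
    rw [← hb] at h
    exact h.symm
  refine ⟨g, (inv_mul_eq_one.1 ?_)⟩
  refine Subtype.ext (IsAutomorphism.eq_one_of_apply_eq ((autHom hτ hσ 𝓜 g)⁻¹ * F).2 hτ hσ hT2
    (ξ := D.toQuot hD C a) ha ?_)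
  rw [← map_inv]
  show g⁻¹ • F.1 (D.toQuot hD C a) = _
  rw [← hb, smul_toQuot, inv_smul_smul]

end GermData

end GermLam

/-! ### The isomorphism and the homeomorphism onto the lamination -/

theorem mainTheorem12 {n : ℕ} {X : Type*} [TopologicalSpace X] [T2Space X]
    [FirstCountableTopology X] {Lt : Type*} [TopologicalSpace Lt] {G : Type*} [Group G]
    [MulAction G Lt] (D : GermLam.GermData n X Lt G) (hD : D.IsGroup) (hTame : D.IsTame)
    (τ : TopologicalSpace D.Cover) (hτ : D.IsEquivariantTopology hD τ)
    (C : Subgroup (D.group hD)) [C.Normal]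
    (σ : TopologicalSpace D.Cover) (hσ : D.IsCoveringTopology hD C τ σ)
    (𝓜 : D.QuotLamination hD C σ) (hT2 : @T2Space (D.Quot hD C) (D.quotTop hD C σ)) :
    (∃ e : (D.group hD ⧸ C) ≃* GermLam.GermData.Aut D hD C 𝓜,
      ∀ (g : D.group hD) (a : D.Cover),
        (e (g : D.group hD ⧸ C)).1 (D.toQuot hD C a) = D.toQuot hD C (g • a)) ∧
    ∃ f : MulAction.orbitRel.Quotient (GermLam.GermData.Aut D hD C 𝓜) (D.Quot hD C) → X,
      @IsHomeomorph _ _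
        ((D.quotTop hD C σ).coinduced
          (Quotient.mk (MulAction.orbitRel (GermLam.GermData.Aut D hD C 𝓜) (D.Quot hD C)))) _ f ∧
      ∀ ξ : D.Quot hD C,
        f (Quotient.mk (MulAction.orbitRel (GermLam.GermData.Aut D hD C 𝓜) (D.Quot hD C)) ξ) =
          D.proj hD C ξ := by
  have hσ' := hσ.isCandidate
  refine ⟨?_, ?_⟩
  · have hker : C ≤ (GermLam.GermData.autHom hτ hσ' 𝓜).ker := fun g hg =>
      MonoidHom.mem_ker.2 ((GermLam.GermData.autHom_eq_one_iff hτ hσ' 𝓜).2 hg)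
    refine ⟨MulEquiv.ofBijective (QuotientGroup.lift C (GermLam.GermData.autHom hτ hσ' 𝓜) hker)
      ⟨?_, ?_⟩, fun g a => rfl⟩
    · rw [injective_iff_map_eq_one]
      intro q hq
      obtain ⟨g, rfl⟩ := QuotientGroup.mk_surjective q
      exact (QuotientGroup.eq_one_iff g).2 ((GermLam.GermData.autHom_eq_one_iff hτ hσ' 𝓜).1 hq)
    · intro F
      obtain ⟨g, rfl⟩ := GermLam.GermData.autHom_surjective hTame hτ hσ' 𝓜 hT2 F
      exact ⟨g, rfl⟩
  · have hproj : Continuous[D.quotTop hD C σ, inferInstance] (D.proj hD C) := by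
      obtain ⟨𝓜', -, h, -⟩ := hσ'.lamination
      exact h.continuous
    refine ⟨Quotient.lift (D.proj hD C) ?_, ?_, fun ξ => rfl⟩
    · rintro _ ξ ⟨F, rfl⟩
      exact F.2.proj_eq ξ
    · refine @IsHomeomorph.mk _ _ (_) _ _ (continuous_coinduced_dom.2 hproj) ?_ ⟨?_, ?_⟩
      · intro V hV
        -- The preimage of `V` under both quotient maps is `σ`-open, hence `τ`-open, and its image
        -- under `lim` is the image of `V`.
        have hV' := hσ'.id_open _ (isOpen_coinduced.1 (isOpen_coinduced.1 hV))
        convert hτ.isOpen_image_lim hV' using 1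
        ext x
        constructor
        · rintro ⟨q, hq, rfl⟩
          obtain ⟨ξ, rfl⟩ := Quotient.exists_rep q
          obtain ⟨a, rfl⟩ := GermLam.GermData.toQuot_surjective ξ
          exact ⟨a, hq, rfl⟩
        · rintro ⟨a, ha, rfl⟩
          exact ⟨_, ha, rfl⟩
      · intro q q' h
        obtain ⟨ξ, rfl⟩ := Quotient.exists_rep q
        obtain ⟨a, rfl⟩ := GermLam.GermData.toQuot_surjective ξ
        obtain ⟨ξ', rfl⟩ := Quotient.exists_rep q'
        obtain ⟨b, rfl⟩ := GermLam.GermData.toQuot_surjective ξ'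
        obtain ⟨g, rfl⟩ := GermLam.GermData.exists_smul_eq (hD := hD) hTame
          (show D.lim b = D.lim a from h.symm)
        exact Quotient.sound ⟨GermLam.GermData.autHom hτ hσ' 𝓜 g, rfl⟩
      · intro x
        obtain ⟨a, rfl⟩ := D.lim_surjective x
        exact ⟨Quotient.mk _ (D.toQuot hD C a), rfl⟩
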